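/- **Setting.** Let $S$ be a nonempty set with an algebra $\Sigma$ of subsets, $X$ a nonempty convex subset of a real vector space, and $\mathcal F$ the set of simple acts, i.e. of $\Sigma$-measurable functions $f:S\to X$ with finite range; mixtures of acts are taken statewise and each $x\in X$ is identified with the constant act $x$. Let $\Delta(S)$ be the set of finitely additive probability measures on $\Sigma$. For $K\subseteq\mathbb R$ let $B_0(\Sigma,K)$ be the set of $\Sigma$-measurable functions $S\to K$ with finite range, with the supremum norm. For a binary relation $\succsim$ on $\mathcal F$, let $\succ$ and $\sim$ be its asymmetric and symmetric parts. The relation $\succsim$ is *MBA* if it satisfies: - *weak order*: $\succsim$ is complete and transitive; - *risk independence*: for all $x,y,z\in X$ and $\alpha\in(0,1)$, $x\sim y$ implies $\alpha x+(1-\alpha)z\sim\alpha y+(1-\alpha)z$, and $x\succ y$ implies $\alpha x+(1-\alpha)z\succ\alpha y+(1-\alpha)z$; - *Archimedean continuity*: if $f\succ g\succ h$ in $\mathcal F$, there are $\alpha,\beta\in(0,1)$ with $\alpha f+(1-\alpha)h\succ g\succ\beta f+(1-\beta)h$; - *monotonicity*: if $f(s)\succsim g(s)$ for every $s\in S$,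 then $f\succsim g$. It exhibits *decreasing absolute ambiguity aversion* if for all $f\in\mathcal F$, $x,y,z\in X$ and $\alpha\in(0,1)$ with $y\succsim x$, $$\alpha f+(1-\alpha)x\succsim\alpha z+(1-\alpha)x\implies\alpha f+(1-\alpha)y\succsim\alpha z+(1-\alpha)y.$$ **Theorem 1.** Let $\succsim$ be a binary relation on $\mathcal F$. The following are equivalent. (i) $\succsim$ is MBA and exhibits decreasing absolute ambiguity aversion. (ii) There exist an affine function $u:X\to\mathbb R$ and a set $\mathcal G$ of functions $G:\mathbb R\times\Delta(S)\to[-\infty,\infty]$ such that - each $G\in\mathcal G$ is nondecreasing in the first argument, constant superadditive in the first argument, i.e. $G(t+k,p)\ge G(t,p)+k$ for all $t\in\mathbb R$, $k\ge0$, $p\in\Delta(S)$, and (jointly) quasiconvex on $\mathbb R\times\Delta(S)$; - $\mathcal G$ is linearly continuous: the functional $V(\varphi)=\max_{G\in\mathcal G}\inf_{p\in\Delta(S)}G\left(\int\varphi\,dp,\,p\right)$ on $B_0(\Sigma,u(X))$ is well defined (the maximum is attained at every $\varphi$) and continuous for the supremum norm; - for all $f,g\in\mathcal F$, $f\succsim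 g\iff V(u(f))\ge V(u(g))$; - $V(u(x))=u(x)$ for all $x\in X$. -/

import Mathlib

open Set Topology

namespace AnscombeAumann

/-- A simple map on the state space `S` with values in `Y`: finitely many values, each taken on an
event of the algebra `A`. -/
@[ext]
structure SimpleMap {S : Type*} (A : BooleanSubalgebra (Set S)) (Y : Type*) where
  toFun : S → Y
  finite_range : (range toFun).Finite
  measurable : ∀ y, toFun ⁻¹' {y} ∈ A

namespace SimpleMap

variable {S Y Z W : Type*} {A : BooleanSubalgebra (Set S)}

/-- Every set of the form `f ⁻¹' T` is an event. -/
theorem preimage_mem (f : SimpleMap A Y) (T : Set Y) : f.toFun ⁻¹' T ∈ A := by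
  have key : ∀ V : Set Y, V.Finite → f.toFun ⁻¹' V ∈ A := by
    intro V hV
    induction V, hV using Set.Finite.induction_on with
    | empty => simpa using A.bot_mem
    | @insert a V _ _ ih =>
      rw [Set.insert_eq, Set.preimage_union]
      exact A.sup_mem (f.measurable a) ih
  have h : f.toFun ⁻¹' T = f.toFun ⁻¹' (T ∩ range f.toFun) := by
    ext s; simp
  rw [h]
  exact key _ (f.finite_range.subset inter_subset_right)

/-- The constant map. -/
def const (A : BooleanSubalgebra (Set S)) (y : Y) : SimpleMap A Y where
  toFun := fun _ => y
  finite_range := (Set.finite_singleton y).subset (by rintro _ ⟨_, rfl⟩; rfl)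
  measurable := by
    intro z
    by_cases h : y = z
    · have : (fun _ : S => y) ⁻¹' {z} = ⊤ := by ext s; simp [h]
      rw [this]; exact A.top_mem
    · have : (fun _ : S => y) ⁻¹' {z} = ⊥ := by ext s; simp [h]
      rw [this]; exact A.bot_mem

/-- Composition of a simple map with a function of its values. -/
def map (F : Y → Z) (f : SimpleMap A Y) : SimpleMap A Z where
  toFun := fun s => F (f.toFun s)
  finite_range := by
    have h : range (fun s => F (f.toFun s)) = F '' range f.toFun := by
      rw [← Set.range_comp]; rfl
    rw [h]; exact f.finite_range.image F
  measurable := fun z => f.preimage_mem (F ⁻¹' {z})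

/-- The pair of two simple maps. -/
def pair (f : SimpleMap A Y) (g : SimpleMap A Z) : SimpleMap A (Y × Z) where
  toFun := fun s => (f.toFun s, g.toFun s)
  finite_range := (f.finite_range.prod g.finite_range).subset (by
    rintro _ ⟨s, rfl⟩; exact ⟨⟨s, rfl⟩, ⟨s, rfl⟩⟩)
  measurable := by
    rintro ⟨y, z⟩
    have h : (fun s => (f.toFun s, g.toFun s)) ⁻¹' {(y, z)}
        = f.toFun ⁻¹' {y} ⊓ g.toFun ⁻¹' {z} := by
      ext s; simp [Prod.ext_iff]
    rw [h]
    exact A.inf_mem (f.measurable y) (g.measurable z)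

end SimpleMap

/-- The set `B₀(Σ, K)` of simple measurable functions with values in `K ⊆ ℝ`. -/
abbrev B0 {S : Type*} (A : BooleanSubalgebra (Set S)) (K : Set ℝ) : Type _ := SimpleMap A K

/-- The (simple) acts: simple measurable maps from states to consequences. -/
abbrev Act {S E : Type*} (A : BooleanSubalgebra (Set S)) (X : Set E) : Type _ := SimpleMap A X

/-- The supremum distance between two elements of `B₀(Σ, K)`. -/
noncomputable def supDist {S : Type*} {A : BooleanSubalgebra (Set S)} {K : Set ℝ}
    (φ ψ : B0 A K) : ℝ := ⨆ s, |(φ.toFun s : ℝ) - (ψ.toFun s : ℝ)|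

/-- Continuity, for the supremum distance, of an extended real-valued functional on `B₀(Σ, K)`. -/
def SupContinuous {S : Type*} {A : BooleanSubalgebra (Set S)} {K : Set ℝ}
    (I : B0 A K → EReal) : Prop :=
  ∀ φ, ∀ U ∈ 𝓝 (I φ), ∃ δ > 0, ∀ ψ, supDist ψ φ < δ → I ψ ∈ U

/-- A finitely additive probability measure on the algebra `A`. -/
@[ext]
structure FinAddProb {S : Type*} (A : BooleanSubalgebra (Set S)) where
  toFun : A → ℝ
  nonneg : ∀ B, 0 ≤ toFun B
  total : toFun ⊤ = 1
  additive : ∀ B C : A, Disjoint (B : Set S) (C : Set S) → toFun (B ⊔ C) = toFun B + toFun C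

namespace FinAddProb

variable {S : Type*} {A : BooleanSubalgebra (Set S)}

/-- The convex combination `α p + (1 - α) q`. -/
noncomputable def mix (α : unitInterval) (p q : FinAddProb A) : FinAddProb A where
  toFun := fun B => (α : ℝ) * p.toFun B + (1 - (α : ℝ)) * q.toFun B
  nonneg := fun B => add_nonneg (mul_nonneg α.2.1 (p.nonneg B))
    (mul_nonneg (sub_nonneg.2 α.2.2) (q.nonneg B))
  total := by rw [p.total, q.total]; ring
  additive := fun B C h => by rw [p.additive B C h, q.additive B C h]; ring

/-- The integral `∫ φ dp` of a real-valued simple function: the sum over the values `r` of `φ` of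
`r * p (φ = r)`. -/
noncomputable def integral (p : FinAddProb A) (φ : SimpleMap A ℝ) : ℝ :=
  ∑ r ∈ φ.finite_range.toFinset, r * p.toFun ⟨φ.toFun ⁻¹' {r}, φ.measurable r⟩

end FinAddProb

section Preferences

variable {S E : Type*} {A : BooleanSubalgebra (Set S)} [AddCommGroup E] [Module ℝ E] {X : Set E}

/-- The convex combination `α x + (1 - α) y` of two consequences. -/
def mixX (hX : Convex ℝ X) (α : unitInterval) (x y : X) : X :=
  ⟨(α : ℝ) • (x : E) + (1 - (α : ℝ)) • (y : E),
    hX x.2 y.2 α.2.1 (sub_nonneg.2 α.2.2) (by ring)⟩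

/-- The statewise convex combination `α f + (1 - α) g` of two acts. -/
def mix (hX : Convex ℝ X) (α : unitInterval) (f g : Act A X) : Act A X :=
  (SimpleMap.pair f g).map fun z => mixX hX α z.1 z.2

/-- Asymmetric part of a relation. -/
def Strict {T : Type*} (R : T → T → Prop) (f g : T) : Prop := R f g ∧ ¬ R g f

/-- Symmetric part of a relation. -/
def Indiff {T : Type*} (R : T → T → Prop) (f g : T) : Prop := R f g ∧ R g f

/-- Weak order: complete and transitive. -/
def WeakOrder (R : Act A X → Act A X → Prop) : Prop :=
  (∀ f g, R f g ∨ R g f) ∧ ∀ f g h, R f g → R g h → R f h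

/-- Risk independence: mixing with a common consequence preserves both indifference and strict
preference between consequences. -/
def RiskIndependence (hX : Convex ℝ X) (R : Act A X → Act A X → Prop) : Prop :=
  ∀ (x y z : X) (α : unitInterval), α ∈ Ioo (0 : unitInterval) 1 →
    (Indiff R (.const A x) (.const A y) →
      Indiff R (mix hX α (.const A x) (.const A z)) (mix hX α (.const A y) (.const A z))) ∧
    (Strict R (.const A x) (.const A y) →
      Strict R (mix hX α (.const A x) (.const A z)) (mix hX α (.const A y) (.const A z)))

/-- Archimedean continuity. -/
def ArchimedeanContinuity (hX : Convex ℝ X) (R : Act A X → Act A X → Prop) : Prop :=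
  ∀ f g h : Act A X, Strict R f g → Strict R g h →
    ∃ α ∈ Ioo (0 : unitInterval) 1, ∃ β ∈ Ioo (0 : unitInterval) 1,
      Strict R (mix hX α f h) g ∧ Strict R g (mix hX β f h)

/-- Monotonicity. -/
def Monotonicity (R : Act A X → Act A X → Prop) : Prop :=
  ∀ f g : Act A X, (∀ s, R (.const A (f.toFun s)) (.const A (g.toFun s))) → R f g

/-- Monotone, Bernoulli, Archimedean preferences. -/
structure IsMBA (hX : Convex ℝ X) (R : Act A X → Act A X → Prop) : Prop where
  weakOrder : WeakOrder R
  riskIndependence : RiskIndependence hX R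
  archimedean : ArchimedeanContinuity hX R
  monotonicity : Monotonicity R

/-- Decreasing absolute ambiguity aversion. -/
def DecreasingAbsoluteAmbiguityAversion (hX : Convex ℝ X) (R : Act A X → Act A X → Prop) : Prop :=
  ∀ (f : Act A X) (x y z : X) (α : unitInterval), α ∈ Ioo (0 : unitInterval) 1 →
    R (.const A y) (.const A x) →
    R (mix hX α f (.const A x)) (mix hX α (.const A z) (.const A x)) →
    R (mix hX α f (.const A y)) (mix hX α (.const A z) (.const A y))

/-- Affine functions on the convex set of consequences. -/
def IsAffine (hX : Convex ℝ X) (u : X → ℝ) : Prop :=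
  ∀ (x y : X) (α : unitInterval), u (mixX hX α x y) = (α : ℝ) * u x + (1 - (α : ℝ)) * u y

/-- The utility profile `u(f) : s ↦ u (f s)`, an element of `B₀(Σ, u(X))`. -/
def utilityProfile (u : X → ℝ) (f : Act A X) : B0 A (range u) :=
  f.map fun x => ⟨u x, mem_range_self x⟩

end Preferences

section Aggregators

variable {S : Type*} {A : BooleanSubalgebra (Set S)}

/-- `G` is monotone in the first argument. -/
def MonotoneFst (G : ℝ → FinAddProb A → EReal) : Prop :=
  ∀ p, Monotone fun t => G t p

/-- `G` is constant superadditive in the first argument. -/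
def ConstSuperadditiveFst (G : ℝ → FinAddProb A → EReal) : Prop :=
  ∀ (p : FinAddProb A) (t k : ℝ), 0 ≤ k → G t p + (k : EReal) ≤ G (t + k) p

/-- `G` is (jointly) quasiconvex on `ℝ × Δ(S)`. -/
def IsQuasiconvex (G : ℝ → FinAddProb A → EReal) : Prop :=
  ∀ (t t' : ℝ) (p p' : FinAddProb A) (α : unitInterval),
    G ((α : ℝ) * t + (1 - (α : ℝ)) * t') (FinAddProb.mix α p p') ≤ max (G t p) (G t' p')

/-- The infimum over `p ∈ Δ(S)` of `G (∫ φ dp, p)`. -/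
noncomputable def infValue {K : Set ℝ} (G : ℝ → FinAddProb A → EReal) (φ : B0 A K) : EReal :=
  ⨅ p : FinAddProb A, G (p.integral (φ.map Subtype.val)) p

/-- The supremum over `G ∈ 𝒢` of `inf_p G (∫ φ dp, p)`; a maximum as soon as it is attained. -/
noncomputable def maxInfValue {K : Set ℝ} (𝒢 : Set (ℝ → FinAddProb A → EReal)) (φ : B0 A K) :
    EReal :=
  ⨆ G ∈ 𝒢, infValue G φ

/-- `𝒢` is linearly continuous on `B₀(Σ, K)`: the functional `φ ↦ max_{G ∈ 𝒢} inf_p G (∫ φ dp, p)`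
is well defined (the maximum is attained at every `φ`) and continuous. -/
def LinearlyContinuous (K : Set ℝ) (𝒢 : Set (ℝ → FinAddProb A → EReal)) : Prop :=
  (∀ φ : B0 A K, ∃ G ∈ 𝒢, ∀ G' ∈ 𝒢, infValue G' φ ≤ infValue G φ) ∧
  SupContinuous fun φ : B0 A K => maxInfValue 𝒢 φ

end Aggregators

end AnscombeAumann

/-!
The utility `u` is a von Neumann–Morgenstern utility of the restriction of the preference to
consequences (`IsVNM.exists_affine_utility`), and the functional of the representation is the
certainty equivalent: `I f` is the utility of a consequence indifferent to the act `f`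
(`IsMBA.exists_indiff_const`). It depends on the profile `u ∘ f` only, and it is monotone. It is
continuous by Archimedean continuity (`exists_lt_of_forall_sub_lt`), and decreasing absolute
ambiguity aversion makes it constant superadditive: `u ∘ f + k ≤ u ∘ g` with `k ≥ 0`
implies `I f + k ≤ I g` (`IsCertaintyEquivalent.add_le`).

Given this, the aggregators can be written down. For each act `f` let `G_f (t, p)` be
`I f + (t - ∫ u ∘ f dp)` when `t ≥ ∫ u ∘ f dp`, and `-∞` otherwise. It is a nondecreasing function of
the affine expression `t - ∫ u ∘ f dp`, so it is quasiconvex, and it is plainly nondecreasing and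
constant superadditive in `t`. At the profile of an act `g`, the infimum over `p` is attained at
point masses: it is `-∞` unless `u ∘ f ≤ u ∘ g`, in which case it is `I f + min (u ∘ g - u ∘ f)`. By
constant superadditivity this is at most `I g`, with equality for `f = g`, so that the maximum over
all `f` is `I g` (`maxInfValue_profileAggregators`).

Conversely, a maximum of infima inherits monotonicity and constant superadditivity from the
aggregators (`maxInfValue_add_le`), which gives monotonicity and decreasing absolute ambiguity
aversion of the preference; the other properties are read off from the affinity of `u`, the
normalisation on constants, and the continuity of the functional.
-/

namespace AnscombeAumann

/-! ### Expected utility on the set of consequences -/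

section ExpectedUtility

variable {E : Type*} [AddCommGroup E] [Module ℝ E] {X : Set E}

/-- The von Neumann–Morgenstern conditions on a relation between the points of a convex set. -/
structure IsVNM (hX : Convex ℝ X) (ρ : X → X → Prop) : Prop where
  total : ∀ x y, ρ x y ∨ ρ y x
  trans : ∀ x y z, ρ x y → ρ y z → ρ x z
  mix_indiff : ∀ (x y z : X) (α : unitInterval), α ∈ Ioo (0 : unitInterval) 1 →
    Indiff ρ x y → Indiff ρ (mixX hX α x z) (mixX hX α y z)
  mix_strict : ∀ (x y z : X) (α : unitInterval), α ∈ Ioo (0 : unitInterval) 1 →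
    Strict ρ x y → Strict ρ (mixX hX α x z) (mixX hX α y z)
  archimedean : ∀ x y z : X, Strict ρ x y → Strict ρ y z →
    ∃ α ∈ Ioo (0 : unitInterval) 1, ∃ β ∈ Ioo (0 : unitInterval) 1,
      Strict ρ (mixX hX α x z) y ∧ Strict ρ y (mixX hX β x z)

theorem mixX_symm (hX : Convex ℝ X) (α : unitInterval) (x y : X) :
    mixX hX (unitInterval.symm α) x y = mixX hX α y x := by
  apply Subtype.ext
  simp only [mixX, unitInterval.coe_symm_eq]
  module

theorem mixX_self (hX : Convex ℝ X) (α : unitInterval) (x : X) : mixX hX α x x = x := by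
  apply Subtype.ext
  simp only [mixX]
  module

theorem symm_mem_Ioo {α : unitInterval} (hα : α ∈ Ioo (0 : unitInterval) 1) :
    unitInterval.symm α ∈ Ioo (0 : unitInterval) 1 := by
  constructor
  · rw [← Subtype.coe_lt_coe]; simp; exact hα.2
  · rw [← Subtype.coe_lt_coe]; simp; exact hα.1

/-- Positive weights `l`, `m` normalise to an interior mixture coefficient. -/
theorem exists_mem_Ioo_eq_div {l m : ℝ} (hl : 0 < l) (hm : 0 < m) :
    ∃ α ∈ Ioo (0 : unitInterval) 1, (α : ℝ) = l / (l + m) := by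
  have h0 : 0 < l / (l + m) := by positivity
  have h1 : l / (l + m) < 1 := by rw [div_lt_one (by positivity)]; linarith
  exact ⟨⟨_, h0.le, h1.le⟩, ⟨h0, h1⟩, rfl⟩

/-- The set of positive multiples of differences of points of `X`: the direction space of the
affine span of `X`. -/
def directionSubmodule (hX : Convex ℝ X) (hne : X.Nonempty) : Submodule ℝ E where
  carrier := {v | ∃ l : ℝ, 0 < l ∧ ∃ x y : X, v = l • ((x : E) - y)}
  zero_mem' := ⟨1, one_pos, ⟨_, hne.some_mem⟩, ⟨_, hne.some_mem⟩, by simp⟩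
  add_mem' := by
    rintro _ _ ⟨l, hl, x, y, rfl⟩ ⟨m, hm, x', y', rfl⟩
    obtain ⟨α, -, hα⟩ := exists_mem_Ioo_eq_div hl hm
    refine ⟨l + m, by positivity, mixX hX α x x', mixX hX α y y', ?_⟩
    simp only [mixX, hα]
    have : l + m ≠ 0 := by positivity
    match_scalars <;> field_simp <;> ring
  smul_mem' := by
    rintro c _ ⟨l, hl, x, y, rfl⟩
    rcases lt_trichotomy c 0 with hc | rfl | hc
    · exact ⟨-c * l, mul_pos (neg_pos.2 hc) hl, y, x, by module⟩
    · exact ⟨1, one_pos, x, x, by simp⟩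
    · exact ⟨c * l, mul_pos hc hl, x, y, by module⟩

namespace IsVNM

variable {hX : Convex ℝ X} {ρ : X → X → Prop}

theorem refl (h : IsVNM hX ρ) (x : X) : ρ x x := (h.total x x).elim id id

theorem strict_of_not (h : IsVNM hX ρ) {x y : X} (hxy : ¬ ρ x y) : Strict ρ y x :=
  ⟨(h.total x y).resolve_left hxy, hxy⟩

theorem mix_right (h : IsVNM hX ρ) {x y : X} (z : X) {α : unitInterval}
    (hα : α ∈ Ioo (0 : unitInterval) 1) (hxy : ρ x y) :
    ρ (mixX hX α x z) (mixX hX α y z) := by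
  by_cases hyx : ρ y x
  · exact (h.mix_indiff x y z α hα ⟨hxy, hyx⟩).1
  · exact (h.mix_strict x y z α hα ⟨hxy, hyx⟩).1

theorem mix_mix (h : IsVNM hX ρ) {x y x' y' : X} {α : unitInterval}
    (hα : α ∈ Ioo (0 : unitInterval) 1) (hxy : ρ x y) (hxy' : ρ x' y') :
    ρ (mixX hX α x x') (mixX hX α y y') := by
  refine h.trans _ _ _ (h.mix_right x' hα hxy) ?_
  rw [← mixX_symm hX α x' y, ← mixX_symm hX α y' y]
  exact h.mix_right y (symm_mem_Ioo hα) hxy'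

/-- The convex cone generated by the differences `x - y` with `x` weakly preferred to `y`. -/
def cone (h : IsVNM hX ρ) (hne : X.Nonempty) : PointedCone ℝ E where
  carrier := {v | ∃ l : ℝ, 0 < l ∧ ∃ x y : X, ρ x y ∧ v = l • ((x : E) - y)}
  zero_mem' := ⟨1, one_pos, ⟨_, hne.some_mem⟩, ⟨_, hne.some_mem⟩, h.refl _, by simp⟩
  add_mem' := by
    rintro _ _ ⟨l, hl, x, y, hxy, rfl⟩ ⟨m, hm, x', y', hxy', rfl⟩
    obtain ⟨α, hα', hα⟩ := exists_mem_Ioo_eq_div hl hm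
    refine ⟨l + m, by positivity, mixX hX α x x', mixX hX α y y', h.mix_mix hα' hxy hxy', ?_⟩
    simp only [mixX, hα]
    have : l + m ≠ 0 := by positivity
    match_scalars <;> field_simp <;> ring
  smul_mem' := by
    rintro ⟨c, hc0⟩ _ ⟨l, hl, x, y, hxy, rfl⟩
    rcases hc0.eq_or_lt with rfl | hc
    · refine ⟨1, one_pos, x, x, h.refl x, ?_⟩
      simp [Nonneg.mk_smul]
    · refine ⟨c * l, mul_pos hc hl, x, y, hxy, ?_⟩
      rw [Nonneg.mk_smul]
      module

theorem sub_mem_cone (h : IsVNM hX ρ) (hne : X.Nonempty) {x y : X} (hxy : ρ x y) :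
    (x : E) - y ∈ h.cone hne := ⟨1, one_pos, x, y, hxy, by simp⟩

theorem smul_mem_cone (h : IsVNM hX ρ) (hne : X.Nonempty) {v : E} {c : ℝ} (hc : 0 ≤ c)
    (hv : v ∈ h.cone hne) : c • v ∈ h.cone hne :=
  (h.cone hne).smul_mem hc hv

/-- By independence the sign of a difference `x - y` does not depend on the pair of points that
represents its direction. -/
theorem rel_of_sub_mem_cone (h : IsVNM hX ρ) (hne : X.Nonempty) {x y : X}
    (hxy : (x : E) - y ∈ h.cone hne) : ρ x y := by
  obtain ⟨l, hl, x', y', hxy', hv⟩ := hxy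
  by_contra hn
  obtain ⟨α, hα', hα⟩ := exists_mem_Ioo_eq_div one_pos hl
  have hs := h.mix_strict y x x' α hα' (h.strict_of_not hn)
  have he : mixX hX α y x' = mixX hX α x y' := by
    apply Subtype.ext
    have hx : (x : E) = y + l • ((x' : E) - y') := by rw [← hv]; abel
    simp only [mixX, hα, hx]
    have : 1 + l ≠ 0 := by positivity
    match_scalars <;> field_simp <;> ring
  rw [he] at hs
  exact hs.2 (h.mix_mix hα' (h.refl x) hxy')

theorem exists_mix_rel (h : IsVNM hX ρ) {a m : X} (ham : Strict ρ a m) (x : X) :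
    ∃ α ∈ Ioo (0 : unitInterval) 1, ρ (mixX hX α a x) m := by
  by_cases hx : ρ x m
  · obtain ⟨α, hα, -⟩ := exists_mem_Ioo_eq_div one_pos one_pos
    exact ⟨α, hα, by simpa only [mixX_self] using h.mix_mix hα ham.1 hx⟩
  · obtain ⟨α, hα, -, -, hs, -⟩ := h.archimedean a m x ham (h.strict_of_not hx)
    exact ⟨α, hα, hs.1⟩

theorem exists_rel_mix (h : IsVNM hX ρ) {b m : X} (hmb : Strict ρ m b) (y : X) :
    ∃ α ∈ Ioo (0 : unitInterval) 1, ρ m (mixX hX α b y) := by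
  by_cases hy : ρ m y
  · obtain ⟨α, hα, -⟩ := exists_mem_Ioo_eq_div one_pos one_pos
    exact ⟨α, hα, by simpa only [mixX_self] using h.mix_mix hα hmb.1 hy⟩
  · obtain ⟨-, -, β, hβ, -, hs⟩ := h.archimedean y m b (h.strict_of_not hy) hmb
    exact ⟨_, symm_mem_Ioo hβ, by rw [mixX_symm]; exact hs.1⟩

/-- The cone is Archimedean: a strict preference direction, suitably scaled, outweighs any
direction. -/
theorem exists_smul_add_mem_cone (h : IsVNM hX ρ) (hne : X.Nonempty) {a b : X}
    (hab : Strict ρ a b) (x y : X) :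
    ∃ T : ℝ, 0 < T ∧ T • ((a : E) - b) + ((x : E) - y) ∈ h.cone hne := by
  obtain ⟨γ, hγ, -⟩ := exists_mem_Ioo_eq_div one_pos one_pos
  set m := mixX hX γ a b with hm
  have hmb : Strict ρ m b := by
    simpa only [mixX_self] using h.mix_strict a b b γ hγ hab
  have ham : Strict ρ a m := by
    have := h.mix_strict a b a _ (symm_mem_Ioo hγ) hab
    rwa [mixX_self, mixX_symm] at this
  obtain ⟨α, ⟨hα0, hα1⟩, hα⟩ := h.exists_mix_rel ham x
  obtain ⟨β, ⟨hβ0, hβ1⟩, hβ⟩ := h.exists_rel_mix hmb y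
  replace hα0 : (0 : ℝ) < α := hα0
  replace hα1 : (0 : ℝ) < 1 - α := sub_pos.2 hα1
  replace hβ0 : (0 : ℝ) < β := hβ0
  replace hβ1 : (0 : ℝ) < 1 - β := sub_pos.2 hβ1
  refine ⟨α / (1 - α) + β / (1 - β), by positivity, ?_⟩
  have h1 := h.smul_mem_cone hne (c := 1 / (1 - α)) (by positivity) (h.sub_mem_cone hne hα)
  have h2 := h.smul_mem_cone hne (c := 1 / (1 - β)) (by positivity) (h.sub_mem_cone hne hβ)
  have h3 := h.smul_mem_cone hne (c := α / (1 - α)) (by positivity) (h.sub_mem_cone hne hmb.1)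
  have h4 := h.smul_mem_cone hne (c := β / (1 - β)) (by positivity) (h.sub_mem_cone hne ham.1)
  convert add_mem (add_mem h1 h2) (add_mem h3 h4) using 1
  clear_value m
  simp only [mixX]
  match_scalars <;> field_simp <;> ring

/-- **von Neumann–Morgenstern theorem.** A supporting functional of the preference cone, obtained
from M. Riesz's extension theorem, is an affine utility. -/
theorem exists_affine_utility (h : IsVNM hX ρ) (hne : X.Nonempty) :
    ∃ u : X → ℝ, IsAffine hX u ∧ ∀ x y, ρ x y ↔ u y ≤ u x := by
  by_cases hdeg : ∀ x y, ρ x y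
  · exact ⟨fun _ => 0, fun _ _ _ => by simp, fun x y => by simp [hdeg x y]⟩
  push Not at hdeg
  obtain ⟨b, a, hba⟩ := hdeg
  have hab := h.strict_of_not hba
  have hD : ∀ x y : X, (x : E) - y ∈ directionSubmodule hX hne :=
    fun x y => ⟨1, one_pos, x, y, by simp⟩
  let e : directionSubmodule hX hne := ⟨(a : E) - b, hD a b⟩
  have he : e ≠ 0 := by
    intro he
    have : (a : E) = b := sub_eq_zero.1 (congrArg Subtype.val he)
    rw [Subtype.ext this] at hba
    exact hba (h.refl _)
  let s : PointedCone ℝ (directionSubmodule hX hne) :=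
    (h.cone hne).comap (directionSubmodule hX hne).subtype
  let f : directionSubmodule hX hne →ₗ.[ℝ] ℝ := LinearPMap.mkSpanSingleton e 1 he
  have hf : ∀ (t : ℝ) (ht : t • e ∈ f.domain), f ⟨t • e, ht⟩ = t := by
    intro t ht
    have := LinearPMap.mkSpanSingleton'_apply (σ := RingHom.id ℝ) e (1 : ℝ)
      (fun c hc => by simp [(smul_eq_zero.1 hc).resolve_right he]) t ht
    simpa only [RingHom.id_apply, smul_eq_mul, mul_one] using this
  obtain ⟨g, hg1, hg2⟩ := riesz_extension s f
    (by
      rintro ⟨v, hv⟩ hvs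
      obtain ⟨t, rfl⟩ := Submodule.mem_span_singleton.1 hv
      rw [hf t hv]
      by_contra! ht
      apply hba
      apply h.rel_of_sub_mem_cone hne
      have h1 := h.smul_mem_cone hne (c := (-t)⁻¹) (by
        rw [inv_nonneg]; linarith) (show t • ((a : E) - b) ∈ h.cone hne from hvs)
      convert h1 using 1
      have := ht.ne
      match_scalars <;> field_simp)
    (by
      rintro ⟨_, l, hl, x, y, rfl⟩
      obtain ⟨T, -, hT⟩ := h.exists_smul_add_mem_cone hne hab x y
      refine ⟨⟨(l * T) • e, Submodule.smul_mem _ _ (Submodule.mem_span_singleton_self e)⟩, ?_⟩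
      have h1 := h.smul_mem_cone hne hl.le hT
      change (l * T) • ((a : E) - b) + l • ((x : E) - y) ∈ h.cone hne
      convert h1 using 1
      module)
  have hge : g e = 1 := by
    have h1 := hg1 ⟨e, Submodule.mem_span_singleton_self e⟩
    rw [h1]
    exact LinearPMap.mkSpanSingleton_apply ℝ ℝ he 1
  have hsub : ∀ x y : X, g ⟨(x : E) - b, hD x b⟩ - g ⟨(y : E) - b, hD y b⟩
      = g ⟨(x : E) - y, hD x y⟩ := by
    intro x y
    rw [← map_sub]
    congr 1
    apply Subtype.ext
    simp
  refine ⟨fun x => g ⟨(x : E) - b, hD x b⟩, ?_, fun x y => ?_⟩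
  · intro x y α
    beta_reduce
    rw [← smul_eq_mul, ← smul_eq_mul, ← map_smul, ← map_smul, ← map_add]
    congr 1
    apply Subtype.ext
    simp only [mixX, Submodule.coe_add, Submodule.coe_smul]
    module
  · rw [← sub_nonneg, hsub]
    refine ⟨fun hxy => hg2 _ (h.sub_mem_cone hne hxy), fun hxy => ?_⟩
    by_contra hn
    obtain ⟨T, hT0, hT⟩ := h.exists_smul_add_mem_cone hne (h.strict_of_not hn) b a
    have h1 := hg2 (T • ⟨(y : E) - x, hD y x⟩ - e) (by
      change T • ((y : E) - x) - ((a : E) - b) ∈ h.cone hne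
      convert hT using 1
      module)
    rw [map_sub, map_smul, hge, smul_eq_mul, ← hsub] at h1
    rw [← hsub] at hxy
    nlinarith

end IsVNM

end ExpectedUtility

/-! ### Integrals and the functionals `φ ↦ inf_p G (∫ φ dp, p)` -/

namespace FinAddProb

variable {S : Type*} {A : BooleanSubalgebra (Set S)}

theorem empty_eq_zero (p : FinAddProb A) {B : A} (hB : (B : Set S) = ∅) : p.toFun B = 0 := by
  have h := p.additive B B (by rw [hB]; exact disjoint_bot_left)
  rw [sup_idem] at h
  linarith

theorem preimage_finset {Z : Type*} (p : FinAddProb A) (h : SimpleMap A Z) (T : Finset Z) :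
    p.toFun ⟨h.toFun ⁻¹' T, h.preimage_mem T⟩
      = ∑ z ∈ T, p.toFun ⟨h.toFun ⁻¹' {z}, h.measurable z⟩ := by
  classical
  induction T using Finset.induction_on with
  | empty => exact p.empty_eq_zero (by simp)
  | insert a T ha ih =>
    rw [Finset.sum_insert ha, ← ih, ← p.additive]
    · congr 1
      apply Subtype.ext
      change _ = h.toFun ⁻¹' {a} ∪ h.toFun ⁻¹' T
      rw [← preimage_union, Finset.coe_insert, insert_eq]
    · apply Disjoint.preimage
      simpa using ha

theorem sum_preimage_singleton {Z : Type*} (p : FinAddProb A) (h : SimpleMap A Z) :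
    ∑ z ∈ h.finite_range.toFinset, p.toFun ⟨h.toFun ⁻¹' {z}, h.measurable z⟩ = 1 := by
  rw [← preimage_finset, ← p.total]
  congr 1
  apply Subtype.ext
  change _ = univ
  ext s
  simp

/-- Change of variables: the integral may be computed on any finite partition into events on which
the integrand is constant. -/
theorem integral_map {Z : Type*} (p : FinAddProb A) (h : SimpleMap A Z) (F : Z → ℝ) :
    p.integral (h.map F)
      = ∑ z ∈ h.finite_range.toFinset, F z * p.toFun ⟨h.toFun ⁻¹' {z}, h.measurable z⟩ := by
  classical
  have hmaps : ∀ z ∈ h.finite_range.toFinset, F z ∈ (h.map F).finite_range.toFinset := by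
    intro z hz
    obtain ⟨s, rfl⟩ := (Set.Finite.mem_toFinset _).1 hz
    exact (Set.Finite.mem_toFinset _).2 ⟨s, rfl⟩
  rw [← Finset.sum_fiberwise_of_maps_to hmaps, integral]
  refine Finset.sum_congr rfl fun r _ => ?_
  have hr : ∑ z ∈ h.finite_range.toFinset with F z = r,
      F z * p.toFun ⟨h.toFun ⁻¹' {z}, h.measurable z⟩
      = r * ∑ z ∈ h.finite_range.toFinset with F z = r,
        p.toFun ⟨h.toFun ⁻¹' {z}, h.measurable z⟩ := by
    rw [Finset.mul_sum]
    refine Finset.sum_congr rfl fun z hz => ?_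
    rw [(Finset.mem_filter.1 hz).2]
  rw [hr, ← preimage_finset]
  congr 2
  apply Subtype.ext
  ext s
  simp [SimpleMap.map]

theorem integral_add_const_le (p : FinAddProb A) (φ ψ : SimpleMap A ℝ) (k : ℝ)
    (h : ∀ s, φ.toFun s + k ≤ ψ.toFun s) : p.integral φ + k ≤ p.integral ψ := by
  set η := SimpleMap.pair φ ψ with hη
  have h1 : φ = η.map Prod.fst := rfl
  have h2 : ψ = η.map Prod.snd := rfl
  have h3 : k = ∑ z ∈ η.finite_range.toFinset,
      k * p.toFun ⟨η.toFun ⁻¹' {z}, η.measurable z⟩ := by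
    rw [← Finset.mul_sum, sum_preimage_singleton, mul_one]
  rw [h1, h2, integral_map, integral_map, h3, ← Finset.sum_add_distrib]
  refine Finset.sum_le_sum fun z hz => ?_
  obtain ⟨s, rfl⟩ := (Set.Finite.mem_toFinset _).1 hz
  rw [← add_mul]
  exact mul_le_mul_of_nonneg_right (h s) (p.nonneg _)

theorem integral_mix (α : unitInterval) (p q : FinAddProb A) (φ : SimpleMap A ℝ) :
    (mix α p q).integral φ = (α : ℝ) * p.integral φ + (1 - (α : ℝ)) * q.integral φ := by
  simp only [integral, mix, Finset.mul_sum, ← Finset.sum_add_distrib]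
  exact Finset.sum_congr rfl fun r _ => by ring

open Classical in
/-- The point mass at a state. -/
noncomputable def dirac (A : BooleanSubalgebra (Set S)) (s : S) : FinAddProb A where
  toFun := fun B => if s ∈ (B : Set S) then 1 else 0
  nonneg := fun B => by split_ifs <;> norm_num
  total := if_pos (mem_univ s)
  additive := fun B C h => by
    by_cases hB : s ∈ (B : Set S)
    · have hC : s ∉ (C : Set S) := disjoint_left.1 h hB
      simp [hB, hC]
    · simp [hB]

theorem integral_dirac (s : S) (φ : SimpleMap A ℝ) :
    (dirac A s).integral φ = φ.toFun s := by
  classical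
  have hs : φ.toFun s ∈ φ.finite_range.toFinset := (Set.Finite.mem_toFinset _).2 ⟨s, rfl⟩
  rw [integral, Finset.sum_eq_single_of_mem _ hs]
  · simp [dirac]
  · intro r _ hr
    simp [dirac, Ne.symm hr]

end FinAddProb

section Functionals

variable {S : Type*} {A : BooleanSubalgebra (Set S)} {K : Set ℝ}

theorem infValue_add_le {G : ℝ → FinAddProb A → EReal} (hmono : MonotoneFst G)
    (hsuper : ConstSuperadditiveFst G) {φ ψ : B0 A K} {k : ℝ} (hk : 0 ≤ k)
    (h : ∀ s, (φ.toFun s : ℝ) + k ≤ ψ.toFun s) :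
    infValue G φ + (k : EReal) ≤ infValue G ψ := by
  refine le_iInf fun p => ?_
  calc infValue G φ + (k : EReal)
      ≤ G (p.integral (φ.map Subtype.val)) p + (k : EReal) := by
        gcongr
        exact iInf_le _ p
    _ ≤ G (p.integral (φ.map Subtype.val) + k) p := hsuper _ _ _ hk
    _ ≤ G (p.integral (ψ.map Subtype.val)) p :=
        hmono p (p.integral_add_const_le _ _ k h)

/-- Monotonicity (`k = 0`) and constant superadditivity pass from the aggregators to the
max-inf functional. -/
theorem maxInfValue_add_le {𝒢 : Set (ℝ → FinAddProb A → EReal)}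
    (h𝒢 : ∀ G ∈ 𝒢, MonotoneFst G ∧ ConstSuperadditiveFst G) {φ ψ : B0 A K} {k : ℝ}
    (hk : 0 ≤ k) (h : ∀ s, (φ.toFun s : ℝ) + k ≤ ψ.toFun s) :
    maxInfValue 𝒢 φ + (k : EReal) ≤ maxInfValue 𝒢 ψ := by
  apply EReal.add_le_of_le_sub
  refine iSup₂_le fun G hG => ?_
  rw [EReal.le_sub_iff_add_le (by simp) (by simp)]
  exact (infValue_add_le (h𝒢 G hG).1 (h𝒢 G hG).2 hk h).trans
    (le_iSup₂ (f := fun G _ => infValue G ψ) G hG)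

theorem maxInfValue_mono {𝒢 : Set (ℝ → FinAddProb A → EReal)}
    (h𝒢 : ∀ G ∈ 𝒢, MonotoneFst G ∧ ConstSuperadditiveFst G) {φ ψ : B0 A K}
    (h : ∀ s, (φ.toFun s : ℝ) ≤ ψ.toFun s) : maxInfValue 𝒢 φ ≤ maxInfValue 𝒢 ψ := by
  simpa using maxInfValue_add_le h𝒢 le_rfl (fun s => by simpa using h s)

theorem finite_range_comp₂ {Y Z W : Type*} (φ : SimpleMap A Y) (ψ : SimpleMap A Z)
    (F : Y → Z → W) : (range fun s => F (φ.toFun s) (ψ.toFun s)).Finite :=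
  ((SimpleMap.pair φ ψ).map fun z : Y × Z => F z.1 z.2).finite_range

theorem abs_sub_le_supDist (φ ψ : B0 A K) (s : S) :
    |(φ.toFun s : ℝ) - (ψ.toFun s : ℝ)| ≤ supDist φ ψ :=
  le_ciSup (finite_range_comp₂ φ ψ fun a b => |(a : ℝ) - (b : ℝ)|).bddAbove s

end Functionals

section Necessity

variable {S E : Type*} {A : BooleanSubalgebra (Set S)} [AddCommGroup E] [Module ℝ E] {X : Set E}
  {hX : Convex ℝ X}

theorem mix_symm (α : unitInterval) (f g : Act A X) :
    mix hX (unitInterval.symm α) f g = mix hX α g f :=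
  SimpleMap.ext (funext fun s => mixX_symm hX α (f.toFun s) (g.toFun s))

theorem mix_const (α : unitInterval) (x y : X) :
    mix hX α (.const A x) (.const A y) = .const A (mixX hX α x y) := rfl

theorem exists_mix_supDist_lt [Nonempty S] {u : X → ℝ} (hu : IsAffine hX u) (f h : Act A X)
    {δ : ℝ} (hδ : 0 < δ) :
    ∃ α ∈ Ioo (0 : unitInterval) 1,
      supDist (utilityProfile u (mix hX α f h)) (utilityProfile u f) < δ := by
  obtain ⟨B, hB⟩ := (finite_range_comp₂ f h fun a b => |u b - u a|).bddAbove
  have hB' : ∀ s, |u (h.toFun s) - u (f.toFun s)| ≤ B := fun s => hB ⟨s, rfl⟩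
  have hB0 : 0 ≤ B := (abs_nonneg _).trans (hB' (Classical.arbitrary S))
  obtain ⟨α, hα, hα'⟩ := exists_mem_Ioo_eq_div (show 0 < B + 1 by linarith) (half_pos hδ)
  refine ⟨α, hα, (ciSup_le fun s => ?_).trans_lt (half_lt_self hδ)⟩
  have h1 : 1 - (α : ℝ) = (δ / 2) / (B + 1 + δ / 2) := by
    rw [hα']; field_simp; ring
  have h2 : 0 ≤ 1 - (α : ℝ) := sub_nonneg.2 α.2.2
  change |u (mixX hX α (f.toFun s) (h.toFun s)) - u (f.toFun s)| ≤ δ / 2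
  rw [hu]
  calc |(α : ℝ) * u (f.toFun s) + (1 - α) * u (h.toFun s) - u (f.toFun s)|
      = (1 - α) * |u (h.toFun s) - u (f.toFun s)| := by
        rw [← abs_of_nonneg h2, ← abs_mul, abs_of_nonneg h2]; congr 1; ring
    _ ≤ (1 - α) * B := by gcongr; exact hB' s
    _ ≤ δ / 2 := by
        rw [h1, div_mul_eq_mul_div, div_le_iff₀ (by positivity)]
        nlinarith

/-- A preference represented by a continuous max-inf functional of constant superadditive
aggregators is MBA and exhibits decreasing absolute ambiguity aversion. -/
theorem isMBA_and_decreasing_of_representation [Nonempty S] {R : Act A X → Act A X → Prop}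
    {u : X → ℝ} {𝒢 : Set (ℝ → FinAddProb A → EReal)} (hu : IsAffine hX u)
    (hcont : SupContinuous fun φ : B0 A (range u) => maxInfValue 𝒢 φ)
    (h𝒢 : ∀ G ∈ 𝒢, MonotoneFst G ∧ ConstSuperadditiveFst G)
    (hR : ∀ f g : Act A X, R f g ↔
      maxInfValue 𝒢 (utilityProfile u g) ≤ maxInfValue 𝒢 (utilityProfile u f))
    (hnorm : ∀ x : X, maxInfValue 𝒢 (utilityProfile u (.const A x)) = (u x : EReal)) :
    IsMBA hX R ∧ DecreasingAbsoluteAmbiguityAversion hX R := by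
  have hRX : ∀ x y : X, R (.const A x) (.const A y) ↔ u y ≤ u x := by
    intro x y
    rw [hR, hnorm, hnorm, EReal.coe_le_coe_iff]
  have hS : ∀ f g : Act A X, Strict R f g ↔
      maxInfValue 𝒢 (utilityProfile u g) < maxInfValue 𝒢 (utilityProfile u f) := by
    intro f g
    rw [Strict, hR, hR, not_le]
    exact ⟨fun h => h.2, fun h => ⟨h.le, h⟩⟩
  refine ⟨⟨⟨fun f g => ?_, fun f g h hfg hgh => ?_⟩, ?_, ?_, fun f g hfg => ?_⟩, ?_⟩
  · rw [hR, hR]; exact le_total _ _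
  · rw [hR] at *; exact hgh.trans hfg
  · intro x y z α hα
    have h0 : (0 : ℝ) < α := hα.1
    simp only [Indiff, Strict, mix_const, hRX, hu _ _ α, not_le]
    refine ⟨fun h => ?_, fun h => ?_⟩
    · rw [le_antisymm h.1 h.2]; exact ⟨le_rfl, le_rfl⟩
    · have := mul_lt_mul_of_pos_left h.2 h0
      exact ⟨by linarith, by linarith⟩
  · intro f g h hfg hgh
    rw [hS] at hfg hgh
    obtain ⟨δ, hδ, hδ'⟩ := hcont (utilityProfile u f) _ (Ioi_mem_nhds hfg)
    obtain ⟨ε, hε, hε'⟩ := hcont (utilityProfile u h) _ (Iio_mem_nhds hgh)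
    obtain ⟨α, hα, hαd⟩ := exists_mix_supDist_lt hu f h hδ
    obtain ⟨β, hβ, hβd⟩ := exists_mix_supDist_lt hu h f hε
    refine ⟨α, hα, unitInterval.symm β, symm_mem_Ioo hβ, ?_, ?_⟩
    · rw [hS]; exact hδ' _ hαd
    · rw [hS, mix_symm]; exact hε' _ hβd
  · rw [hR]
    exact maxInfValue_mono h𝒢 fun s => (hRX _ _).1 (hfg s)
  · intro f x y z α hα hyx h
    rw [hRX] at hyx
    have h1 : 0 ≤ (1 - (α : ℝ)) * (u y - u x) :=
      mul_nonneg (sub_nonneg.2 α.2.2) (sub_nonneg.2 hyx)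
    rw [hR, mix_const, hnorm, hu] at h ⊢
    have h2 := maxInfValue_add_le h𝒢 (φ := utilityProfile u (mix hX α f (.const A x)))
      (ψ := utilityProfile u (mix hX α f (.const A y))) h1 (fun s => by
        change u (mixX hX α (f.toFun s) x) + _ ≤ u (mixX hX α (f.toFun s) y)
        rw [hu, hu]
        apply le_of_eq; ring)
    refine le_trans ?_ h2
    refine le_trans ?_ (add_le_add_left h _)
    rw [← EReal.coe_add, EReal.coe_le_coe_iff]
    apply le_of_eq; ring

end Necessity

/-! ### The certainty-equivalent functional -/

section CertaintyEquivalent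

variable {S E : Type*} {A : BooleanSubalgebra (Set S)} {X : Set E}
  {u : X → ℝ} {R : Act A X → Act A X → Prop} {I : Act A X → ℝ}

theorem SimpleMap.exists_forall_le [Nonempty S] {Y : Type*} (f : SimpleMap A Y) (v : Y → ℝ) :
    ∃ s₀, ∀ s, v (f.toFun s₀) ≤ v (f.toFun s) := by
  obtain ⟨_, ⟨s₀, rfl⟩, h⟩ := Set.exists_min_image _ v f.finite_range (range_nonempty _)
  exact ⟨s₀, fun s => h _ ⟨s, rfl⟩⟩

theorem SimpleMap.exists_forall_ge [Nonempty S] {Y : Type*} (f : SimpleMap A Y) (v : Y → ℝ) :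
    ∃ s₀, ∀ s, v (f.toFun s) ≤ v (f.toFun s₀) := by
  obtain ⟨_, ⟨s₀, rfl⟩, h⟩ := Set.exists_max_image _ v f.finite_range (range_nonempty _)
  exact ⟨s₀, fun s => h _ ⟨s, rfl⟩⟩

/-- `I` assigns to every act the utility of a certainty equivalent, and so represents `R`. -/
structure IsCertaintyEquivalent (R : Act A X → Act A X → Prop) (u : X → ℝ) (I : Act A X → ℝ) :
    Prop where
  rel_iff : ∀ f g, R f g ↔ I g ≤ I f
  const : ∀ x, I (.const A x) = u x
  mem_range : ∀ f, ∃ z, I f = u z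
  mono : ∀ f g : Act A X, (∀ s, u (f.toFun s) ≤ u (g.toFun s)) → I f ≤ I g

theorem IsCertaintyEquivalent.strict_iff (hI : IsCertaintyEquivalent R u I) (f g : Act A X) :
    Strict R f g ↔ I g < I f := by
  rw [Strict, hI.rel_iff, hI.rel_iff, not_le]
  exact ⟨fun h => h.2, fun h => ⟨h.le, h⟩⟩

variable [AddCommGroup E] [Module ℝ E] {hX : Convex ℝ X}

theorem IsAffine.exists_eq (hu : IsAffine hX u) {x y : X} {c : ℝ} (hx : u x ≤ c) (hy : c ≤ u y) :
    ∃ z, u z = c := by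
  rcases hx.eq_or_lt with h | hx'
  · exact ⟨x, h⟩
  have hd : 0 < u y - u x := by linarith
  refine ⟨mixX hX ⟨(c - u x) / (u y - u x), div_nonneg (by linarith) hd.le,
    (div_le_one hd).2 (by linarith)⟩ y x, ?_⟩
  rw [hu]
  field_simp
  ring

theorem IsMBA.isVNM (h : IsMBA hX R) :
    IsVNM hX fun x y => R (.const A x) (.const A y) where
  total := fun _ _ => h.weakOrder.1 _ _
  trans := fun _ _ _ => h.weakOrder.2 _ _ _
  mix_indiff := fun x y z α hα => (h.riskIndependence x y z α hα).1
  mix_strict := fun x y z α hα => (h.riskIndependence x y z α hα).2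
  archimedean := fun _ _ _ hxy hyz => h.archimedean _ _ _ hxy hyz

theorem IsMBA.strict_of_not (h : IsMBA hX R) {f g : Act A X} (hfg : ¬ R f g) : Strict R g f :=
  ⟨(h.weakOrder.1 f g).resolve_left hfg, hfg⟩

/-- Every act is indifferent to some consequence: the supremum of the utilities of the
consequences that it weakly dominates is attained, by Archimedean continuity. -/
theorem IsMBA.exists_indiff_const [Nonempty S] (h : IsMBA hX R) (hu : IsAffine hX u)
    (hR : ∀ x y, R (.const A x) (.const A y) ↔ u y ≤ u x) (f : Act A X) :
    ∃ z : X, Indiff R (.const A z) f := by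
  have htrans := h.weakOrder.2
  obtain ⟨s₀, hs₀⟩ := f.exists_forall_le u
  obtain ⟨s₁, hs₁⟩ := f.exists_forall_ge u
  set m := f.toFun s₀
  set M := f.toFun s₁
  have hfm : R f (.const A m) := h.monotonicity _ _ fun s => (hR _ _).2 (hs₀ s)
  have hMf : R (.const A M) f := h.monotonicity _ _ fun s => (hR _ _).2 (hs₁ s)
  by_cases hmf : R (.const A m) f
  · exact ⟨m, hmf, hfm⟩
  by_cases hfM : R f (.const A M)
  · exact ⟨M, hMf, hfM⟩
  let T : Set ℝ := {c | ∃ x, u x = c ∧ R f (.const A x)}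
  have hTm : u m ∈ T := ⟨m, rfl, hfm⟩
  have hTM : ∀ c ∈ T, c ≤ u M := by
    rintro _ ⟨x, rfl, hx⟩
    exact (hR _ _).1 (htrans _ _ _ hMf hx)
  have hbdd : BddAbove T := ⟨u M, hTM⟩
  obtain ⟨z, hz⟩ := hu.exists_eq (le_csSup hbdd hTm) (csSup_le ⟨_, hTm⟩ hTM)
  refine ⟨z, ?_, ?_⟩
  · by_contra hzf
    obtain ⟨-, -, β, hβ, -, hs⟩ := h.archimedean _ _ _ (h.strict_of_not hfM)
      (h.strict_of_not hzf)
    rw [mix_const] at hs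
    have h1 : u (mixX hX β M z) ≤ u z := by
      rw [hz]; exact le_csSup hbdd ⟨_, rfl, hs.1⟩
    have h2 : u z < u M := by
      by_contra! hle
      exact hzf (htrans _ _ _ ((hR _ _).2 hle) hMf)
    rw [hu] at h1
    have h0 : (0 : ℝ) < β := hβ.1
    nlinarith
  · by_contra hfz
    obtain ⟨α, hα, -, -, hs, -⟩ := h.archimedean _ _ _ (h.strict_of_not hfz)
      (h.strict_of_not hmf)
    rw [mix_const] at hs
    have h2 : u m < u z := by
      by_contra! hle
      exact hfz (htrans _ _ _ hfm ((hR _ _).2 hle))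
    have h1 : u (mixX hX α z m) < u z := by
      have h0 : (α : ℝ) < 1 := hα.2
      rw [hu]
      nlinarith
    rw [hz] at h1
    obtain ⟨_, ⟨x, rfl, hx⟩, hlt⟩ := exists_lt_of_lt_csSup ⟨_, hTm⟩ h1
    exact hs.2 (htrans _ _ _ hx ((hR _ _).2 hlt.le))

theorem IsMBA.exists_isCertaintyEquivalent [Nonempty S] (h : IsMBA hX R) (hu : IsAffine hX u)
    (hR : ∀ x y, R (.const A x) (.const A y) ↔ u y ≤ u x) :
    ∃ I, IsCertaintyEquivalent R u I := by
  choose z hz using h.exists_indiff_const hu hR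
  have hrel : ∀ f g, R f g ↔ u (z g) ≤ u (z f) := by
    intro f g
    rw [← hR]
    exact ⟨fun hfg => h.weakOrder.2 _ _ _ (hz f).1 (h.weakOrder.2 _ _ _ hfg (hz g).2),
      fun hfg => h.weakOrder.2 _ _ _ (hz f).2 (h.weakOrder.2 _ _ _ hfg (hz g).1)⟩
  refine ⟨fun f => u (z f), hrel, fun x => ?_, fun f => ⟨z f, rfl⟩, fun f g hfg => ?_⟩
  · exact le_antisymm ((hR _ _).1 (hz (.const A x)).2) ((hR _ _).1 (hz (.const A x)).1)
  · exact (hrel _ _).1 (h.monotonicity _ _ fun s => (hR _ _).2 (hfg s))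

/-- Lower semicontinuity of a monotone functional on utility profiles. The Archimedean property is
used for mixtures with a consequence `k` that is not better than any value of the act, and that is
either strictly worse than all of them or a worst consequence: then every profile close enough to
that of the act dominates the mixture. -/
theorem exists_lt_of_forall_sub_lt [Nonempty S] (hu : IsAffine hX u)
    (hrange : ∀ f, ∃ z, I f = u z)
    (hmono : ∀ f g : Act A X, (∀ s, u (f.toFun s) ≤ u (g.toFun s)) → I f ≤ I g)
    (harch : ∀ (f : Act A X) (w k : X), u w < I f → u k < u w →
      ∃ α ∈ Ioo (0 : unitInterval) 1, u w < I (mix hX α f (.const A k)))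
    (f : Act A X) {c : ℝ} (hc : c < I f) :
    ∃ δ > 0, ∀ g : Act A X, (∀ s, u (f.toFun s) - δ < u (g.toFun s)) → c < I g := by
  by_cases hx : ∃ x, u x ≤ c
  swap
  · push Not at hx
    refine ⟨1, one_pos, fun g _ => ?_⟩
    obtain ⟨z, hz⟩ := hrange g
    rw [hz]; exact hx z
  obtain ⟨x, hx⟩ := hx
  obtain ⟨c', hc1, hc2⟩ := exists_between hc
  obtain ⟨z, hz⟩ := hrange f
  obtain ⟨w, rfl⟩ := hu.exists_eq (hx.trans hc1.le) (hz ▸ hc2.le)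
  obtain ⟨s₀, hs₀⟩ := f.exists_forall_le u
  obtain ⟨k, hkw, hkf, hk⟩ : ∃ k, u k < u w ∧ (∀ s, u k ≤ u (f.toFun s)) ∧
      ∀ s, u (f.toFun s) = u k → ∀ y, u k ≤ u y := by
    by_cases hmin : ∀ y, u (f.toFun s₀) ≤ u y
    · exact ⟨f.toFun s₀, (hmin x).trans_lt (hx.trans_lt hc1), hs₀, fun _ _ => hmin⟩
    · push Not at hmin
      obtain ⟨y, hy⟩ := hmin
      rcases le_total (u x) (u y) with hxy | hxy
      · exact ⟨x, hx.trans_lt hc1, fun s => by linarith [hs₀ s],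
          fun s hs => by linarith [hs₀ s]⟩
      · exact ⟨y, hxy.trans_lt (hx.trans_lt hc1), fun s => by linarith [hs₀ s],
          fun s hs => by linarith [hs₀ s]⟩
  obtain ⟨α, hα, hαw⟩ := harch f w k hc2 hkw
  have hα1 : (0 : ℝ) < 1 - α := sub_pos.2 hα.2
  -- The least positive value of `u ∘ f - u k`, or `1` if there is none.
  obtain ⟨s₁, hs₁⟩ := f.exists_forall_le fun y => if u k < u y then u y - u k else 1
  set δ : ℝ := if u k < u (f.toFun s₁) then u (f.toFun s₁) - u k else 1 with hδ
  have hδ0 : 0 < δ := by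
    rw [hδ]; split_ifs with h
    · linarith
    · exact one_pos
  refine ⟨(1 - α) * δ, by positivity, fun g hg => hc1.trans (hαw.trans_le (hmono _ _ fun s => ?_))⟩
  change u (mixX hX α (f.toFun s) k) ≤ _
  rw [hu]
  rcases (hkf s).eq_or_lt with h | h
  · have := hk s h.symm (g.toFun s)
    rw [← h]
    linarith
  · have h1 := hs₁ s
    simp only [if_pos h] at h1
    have h2 := hg s
    have h3 := mul_le_mul_of_nonneg_left h1 hα1.le
    linarith

theorem IsCertaintyEquivalent.exists_lt (hI : IsCertaintyEquivalent R u I) [Nonempty S]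
    (h : IsMBA hX R) (hu : IsAffine hX u) (f : Act A X) {c : ℝ} (hc : c < I f) :
    ∃ δ > 0, ∀ g : Act A X, (∀ s, |u (g.toFun s) - u (f.toFun s)| < δ) → c < I g := by
  obtain ⟨δ, hδ, H⟩ := exists_lt_of_forall_sub_lt hu hI.mem_range hI.mono (fun f w k hw hk => by
    rw [← hI.const, ← hI.strict_iff] at hw
    rw [← hI.const, ← hI.const, ← hI.strict_iff] at hk
    obtain ⟨α, hα, -, -, hs, -⟩ := h.archimedean _ _ _ hw hk
    exact ⟨α, hα, by rwa [hI.strict_iff, hI.const] at hs⟩) f hc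
  exact ⟨δ, hδ, fun g hg => H g fun s => by linarith [(abs_lt.1 (hg s)).1]⟩

/-- Upper semicontinuity is lower semicontinuity for the reversed preference, with utility `-u`. -/
theorem IsCertaintyEquivalent.exists_gt (hI : IsCertaintyEquivalent R u I) [Nonempty S]
    (h : IsMBA hX R) (hu : IsAffine hX u) (f : Act A X) {c : ℝ} (hc : I f < c) :
    ∃ δ > 0, ∀ g : Act A X, (∀ s, |u (g.toFun s) - u (f.toFun s)| < δ) → I g < c := by
  obtain ⟨δ, hδ, H⟩ := exists_lt_of_forall_sub_lt (hX := hX) (u := fun x => -u x)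
    (I := fun f => -I f) (fun x y α => by beta_reduce; rw [hu]; ring)
    (fun f => (hI.mem_range f).imp fun z hz => by rw [hz])
    (fun f g hfg => neg_le_neg (hI.mono _ _ fun s => neg_le_neg_iff.1 (hfg s)))
    (fun f w k hw hk => by
      rw [neg_lt_neg_iff, ← hI.const, ← hI.strict_iff] at hw
      rw [neg_lt_neg_iff, ← hI.const, ← hI.const, ← hI.strict_iff] at hk
      obtain ⟨-, -, β, hβ, -, hs⟩ := h.archimedean _ _ _ hk hw
      refine ⟨_, symm_mem_Ioo hβ, ?_⟩
      rwa [neg_lt_neg_iff, mix_symm, ← hI.const, ← hI.strict_iff]) f (neg_lt_neg hc)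
  exact ⟨δ, hδ, fun g hg => neg_lt_neg_iff.1
    (H g fun s => by linarith [(abs_lt.1 (hg s)).2])⟩

/-- Decreasing absolute ambiguity aversion makes the certainty equivalent constant superadditive.
If `m` is the least utility of `f` and `M` the greatest utility of `g`, then `u ∘ f` is the mixture,
with weight `(M - m - k) / (M - m)`, of a profile with values in `[m, M]` and of the constant `m`;
replacing `m` by `M` in this mixture adds `k`. -/
theorem IsCertaintyEquivalent.add_le (hI : IsCertaintyEquivalent R u I) [Nonempty S]
    (hd : DecreasingAbsoluteAmbiguityAversion hX R) (hu : IsAffine hX u) {f g : Act A X} {k : ℝ}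
    (hk : 0 ≤ k) (hfg : ∀ s, u (f.toFun s) + k ≤ u (g.toFun s)) : I f + k ≤ I g := by
  rcases hk.eq_or_lt with rfl | hk
  · simpa using hI.mono f g fun s => by simpa using hfg s
  obtain ⟨s₀, hs₀⟩ := f.exists_forall_le u
  obtain ⟨s₁, hs₁⟩ := g.exists_forall_ge u
  set x := f.toFun s₀
  set y := g.toFun s₁
  have hxf : u x ≤ I f := by rw [← hI.const]; exact hI.mono _ _ hs₀
  have hfy : ∀ s, u (f.toFun s) ≤ u y - k := fun s => by linarith [hs₁ s, hfg s]
  have hIf : I f ≤ u y - k := by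
    obtain ⟨c, hc⟩ := hu.exists_eq (hfy s₀) (by linarith : u y - k ≤ u y)
    rw [← hc, ← hI.const]
    exact hI.mono _ _ fun s => (hfy s).trans hc.ge
  rcases (hfy s₀).eq_or_lt with hxy | hxy
  · have h1 : u y ≤ I g := by
      rw [← hI.const]
      refine hI.mono _ _ fun s => ?_
      have : u y = u x + k := by linarith
      exact this.le.trans (by linarith [hs₀ s, hfg s])
    linarith
  have hD : 0 < u y - u x := by linarith
  have hN : 0 < u y - k - u x := by linarith
  obtain ⟨α, hα, hα'⟩ := exists_mem_Ioo_eq_div hN hk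
  have hsum : u y - k - u x + k = u y - u x := by ring
  rw [hsum] at hα'
  -- The consequence of utility `m + (r - m) / α`, a mixture of `y` and `x` for `r ∈ [m, M - k]`.
  let v : ℝ → X := fun r =>
    mixX hX (projIcc (0 : ℝ) 1 zero_le_one ((r - u x) / (u y - k - u x))) y x
  have hv : ∀ r, u x ≤ r → r ≤ u y - k →
      (α : ℝ) * u (v r) = r - (1 - α) * u x := by
    intro r h1 h2
    simp only [v, hu _ _ _, coe_projIcc, hα']
    rw [min_eq_right ((div_le_one hN).2 (by linarith)),
      max_eq_right (div_nonneg (by linarith) hN.le)]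
    field_simp
    ring
  let h : Act A X := f.map fun w => v (u w)
  have hh : ∀ (t : X) (s : S), u ((mix hX α h (.const A t)).toFun s)
      = u (f.toFun s) + (1 - α) * (u t - u x) := by
    intro t s
    change u (mixX hX α (v (u (f.toFun s))) t) = _
    rw [hu, hv _ (hs₀ s) (hfy s)]
    ring
  have hz : ∀ t : X, I (mix hX α (.const A (v (I f))) (.const A t))
      = I f + (1 - α) * (u t - u x) := by
    intro t
    rw [mix_const, hI.const, hu, hv _ hxf hIf]
    ring
  have h1 := hd h x y (v (I f)) α hα ((hI.rel_iff _ _).2 (by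
    rw [hI.const, hI.const]; linarith)) ((hI.rel_iff _ _).2 (by
    rw [hz]
    refine le_trans (by simp) (hI.mono f _ fun s => ?_)
    rw [hh]; simp))
  rw [hI.rel_iff, hz] at h1
  have hkα : (1 - (α : ℝ)) * (u y - u x) = k := by
    rw [hα']; field_simp; ring
  rw [hkα] at h1
  refine h1.trans (hI.mono _ _ fun s => ?_)
  rw [hh, hkα]
  exact hfg s

end CertaintyEquivalent

/-! ### The aggregators of the representation -/

section Sufficiency

variable {S E : Type*} {A : BooleanSubalgebra (Set S)} {X : Set E} {u : X → ℝ}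
  {I : Act A X → ℝ}

open Classical in
/-- The aggregator `(t, p) ↦ c + (t - ∫ ψ dp)` where `t ≥ ∫ ψ dp`, and `-∞` elsewhere. -/
noncomputable def profileAggregator (c : ℝ) (ψ : SimpleMap A ℝ) (t : ℝ) (p : FinAddProb A) :
    EReal :=
  if p.integral ψ ≤ t then ((c + (t - p.integral ψ) : ℝ) : EReal) else ⊥

/-- The aggregator depends on `t - ∫ ψ dp` only, and increasingly so. -/
theorem profileAggregator_add_le (c : ℝ) (ψ : SimpleMap A ℝ) {t t' k : ℝ} {p p' : FinAddProb A}
    (hk : 0 ≤ k) (h : t - p.integral ψ + k ≤ t' - p'.integral ψ) :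
    profileAggregator c ψ t p + (k : EReal) ≤ profileAggregator c ψ t' p' := by
  unfold profileAggregator
  by_cases ht : p.integral ψ ≤ t
  · rw [if_pos ht, if_pos (by linarith), ← EReal.coe_add, EReal.coe_le_coe_iff]
    linarith
  · simp [if_neg ht]

theorem profileAggregator_mono (c : ℝ) (ψ : SimpleMap A ℝ) {t t' : ℝ} {p p' : FinAddProb A}
    (h : t - p.integral ψ ≤ t' - p'.integral ψ) :
    profileAggregator c ψ t p ≤ profileAggregator c ψ t' p' := by
  simpa using profileAggregator_add_le c ψ (k := 0) le_rfl (by simpa using h)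

theorem monotoneFst_profileAggregator (c : ℝ) (ψ : SimpleMap A ℝ) :
    MonotoneFst (profileAggregator c ψ) :=
  fun _ _ _ h => profileAggregator_mono c ψ (sub_le_sub_right h _)

theorem constSuperadditiveFst_profileAggregator (c : ℝ) (ψ : SimpleMap A ℝ) :
    ConstSuperadditiveFst (profileAggregator c ψ) :=
  fun _ _ _ hk => profileAggregator_add_le c ψ hk (by apply le_of_eq; ring)

/-- A nondecreasing function of the affine map `(t, p) ↦ t - ∫ ψ dp` is quasiconvex. -/
theorem isQuasiconvex_profileAggregator (c : ℝ) (ψ : SimpleMap A ℝ) :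
    IsQuasiconvex (profileAggregator c ψ) := by
  intro t t' p p' α
  have h0 : (0 : ℝ) ≤ α := α.2.1
  have h1 : (0 : ℝ) ≤ 1 - α := sub_nonneg.2 α.2.2
  rcases le_total (t - p.integral ψ) (t' - p'.integral ψ) with h | h
  · refine le_max_of_le_right (profileAggregator_mono c ψ ?_)
    rw [FinAddProb.integral_mix]
    nlinarith
  · refine le_max_of_le_left (profileAggregator_mono c ψ ?_)
    rw [FinAddProb.integral_mix]
    nlinarith

/-- The aggregators attached to all acts, each built from the profile and the certainty equivalent
of the act. -/
def profileAggregators (A : BooleanSubalgebra (Set S)) (u : X → ℝ) (I : Act A X → ℝ) :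
    Set (ℝ → FinAddProb A → EReal) :=
  range fun f : Act A X => profileAggregator (I f) (f.map u)

theorem le_infValue_profileAggregator (c : ℝ) (f : Act A X) :
    (c : EReal) ≤ infValue (profileAggregator c (f.map u)) (utilityProfile u f) := by
  refine le_iInf fun p => ?_
  have h : (utilityProfile u f).map Subtype.val = f.map u := rfl
  simp [profileAggregator, h]

/-- Point masses bound the infimum: it is `-∞` unless the profile of `g` dominates that of `f`, and
otherwise at most `I f` plus the least gap, hence at most `I g` by constant superadditivity. -/
theorem infValue_profileAggregator_le [Nonempty S]
    (hI : ∀ (f g : Act A X) (k : ℝ), 0 ≤ k → (∀ s, u (f.toFun s) + k ≤ u (g.toFun s)) →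
      I f + k ≤ I g) (f g : Act A X) :
    infValue (profileAggregator (I f) (f.map u)) (utilityProfile u g) ≤ I g := by
  obtain ⟨s, hs⟩ := (SimpleMap.pair f g).exists_forall_le fun z => u z.2 - u z.1
  change ∀ t, u (g.toFun s) - u (f.toFun s) ≤ u (g.toFun t) - u (f.toFun t) at hs
  refine (iInf_le _ (FinAddProb.dirac A s)).trans ?_
  rw [FinAddProb.integral_dirac, profileAggregator, FinAddProb.integral_dirac]
  change (if u (f.toFun s) ≤ u (g.toFun s) then
    ((I f + (u (g.toFun s) - u (f.toFun s)) : ℝ) : EReal) else ⊥) ≤ I g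
  split_ifs with h
  · rw [EReal.coe_le_coe_iff]
    exact hI f g _ (sub_nonneg.2 h) fun t => by linarith [hs t]
  · exact bot_le

theorem maxInfValue_profileAggregators [Nonempty S]
    (hI : ∀ (f g : Act A X) (k : ℝ), 0 ≤ k → (∀ s, u (f.toFun s) + k ≤ u (g.toFun s)) →
      I f + k ≤ I g) (g : Act A X) :
    maxInfValue (profileAggregators A u I) (utilityProfile u g) = I g := by
  apply le_antisymm
  · refine iSup₂_le ?_
    rintro _ ⟨f, rfl⟩
    exact infValue_profileAggregator_le hI f g
  · exact (le_infValue_profileAggregator (I g) g).trans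
      (le_iSup₂ (f := fun G _ => infValue G (utilityProfile u g)) _ ⟨g, rfl⟩)

theorem utilityProfile_surjective (φ : B0 A (range u)) :
    ∃ f : Act A X, utilityProfile u f = φ :=
  ⟨φ.map fun r : range u => r.2.choose, SimpleMap.ext (funext fun s => Subtype.ext
    (φ.toFun s).2.choose_spec)⟩

theorem linearlyContinuous_profileAggregators [Nonempty S]
    (hI : ∀ (f g : Act A X) (k : ℝ), 0 ≤ k → (∀ s, u (f.toFun s) + k ≤ u (g.toFun s)) →
      I f + k ≤ I g)
    (hlow : ∀ (f : Act A X) (c : ℝ), c < I f →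
      ∃ δ > 0, ∀ g : Act A X, (∀ s, |u (g.toFun s) - u (f.toFun s)| < δ) → c < I g)
    (hupp : ∀ (f : Act A X) (c : ℝ), I f < c →
      ∃ δ > 0, ∀ g : Act A X, (∀ s, |u (g.toFun s) - u (f.toFun s)| < δ) → I g < c) :
    LinearlyContinuous (range u) (profileAggregators A u I) := by
  refine ⟨fun φ => ?_, fun φ U hU => ?_⟩
  · obtain ⟨g, rfl⟩ := utilityProfile_surjective φ
    refine ⟨_, ⟨g, rfl⟩, ?_⟩
    rintro _ ⟨f, rfl⟩
    exact (infValue_profileAggregator_le hI f g).trans (le_infValue_profileAggregator _ g)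
  · obtain ⟨f, rfl⟩ := utilityProfile_surjective φ
    beta_reduce at hU
    rw [maxInfValue_profileAggregators hI] at hU
    obtain ⟨a, b, ⟨ha, hb⟩, hab⟩ := mem_nhds_iff_exists_Ioo_subset.1
      (continuous_coe_real_ereal.continuousAt.preimage_mem_nhds hU)
    obtain ⟨δ, hδ, hδ'⟩ := hlow f a ha
    obtain ⟨ε, hε, hε'⟩ := hupp f b hb
    refine ⟨min δ ε, lt_min hδ hε, fun ψ hψ => ?_⟩
    obtain ⟨g, rfl⟩ := utilityProfile_surjective ψ
    beta_reduce
    rw [maxInfValue_profileAggregators hI]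
    have hg : ∀ s, |u (g.toFun s) - u (f.toFun s)| < min δ ε :=
      fun s => (abs_sub_le_supDist _ _ s).trans_lt hψ
    exact hab ⟨hδ' g fun s => (hg s).trans_le (min_le_left _ _),
      hε' g fun s => (hg s).trans_le (min_le_right _ _)⟩

end Sufficiency

end AnscombeAumann

theorem theorem1 {S E : Type*} [Nonempty S] (A : BooleanSubalgebra (Set S))
    [AddCommGroup E] [Module ℝ E] (X : Set E) (hX : Convex ℝ X) (hne : X.Nonempty)
    (R : AnscombeAumann.Act A X → AnscombeAumann.Act A X → Prop) :
    (AnscombeAumann.IsMBA hX R ∧ AnscombeAumann.DecreasingAbsoluteAmbiguityAversion hX R) ↔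
    ∃ (u : X → ℝ) (𝒢 : Set (ℝ → AnscombeAumann.FinAddProb A → EReal)),
      AnscombeAumann.IsAffine hX u ∧
      AnscombeAumann.LinearlyContinuous (Set.range u) 𝒢 ∧
      (∀ G ∈ 𝒢, AnscombeAumann.MonotoneFst G ∧ AnscombeAumann.ConstSuperadditiveFst G ∧
        AnscombeAumann.IsQuasiconvex G) ∧
      (∀ f g : AnscombeAumann.Act A X, R f g ↔
        AnscombeAumann.maxInfValue 𝒢 (AnscombeAumann.utilityProfile u f) ≥
          AnscombeAumann.maxInfValue 𝒢 (AnscombeAumann.utilityProfile u g)) ∧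
      (∀ x : X, AnscombeAumann.maxInfValue 𝒢
        (AnscombeAumann.utilityProfile u (.const A x)) = (u x : EReal)) := by
  open AnscombeAumann in
  constructor
  · rintro ⟨h, hd⟩
    obtain ⟨u, hu, hR⟩ := h.isVNM.exists_affine_utility hne
    obtain ⟨I, hI⟩ := h.exists_isCertaintyEquivalent hu hR
    have hadd : ∀ (f g : Act A X) (k : ℝ), 0 ≤ k →
        (∀ s, u (f.toFun s) + k ≤ u (g.toFun s)) → I f + k ≤ I g :=
      fun _ _ _ hk hfg => hI.add_le hd hu hk hfg
    refine ⟨u, profileAggregators A u I, hu,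
      linearlyContinuous_profileAggregators hadd (fun f _ hc => hI.exists_lt h hu f hc)
        (fun f _ hc => hI.exists_gt h hu f hc), ?_, fun f g => ?_, fun x => ?_⟩
    · rintro _ ⟨f, rfl⟩
      exact ⟨monotoneFst_profileAggregator _ _, constSuperadditiveFst_profileAggregator _ _,
        isQuasiconvex_profileAggregator _ _⟩
    · rw [maxInfValue_profileAggregators hadd, maxInfValue_profileAggregators hadd, ge_iff_le,
        EReal.coe_le_coe_iff, hI.rel_iff]
    · rw [maxInfValue_profileAggregators hadd, hI.const]
  · rintro ⟨u, 𝒢, hu, hcont, h𝒢, hR, hnorm⟩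
    exact isMBA_and_decreasing_of_representation hu hcont.2
      (fun G hG => ⟨(h𝒢 G hG).1, (h𝒢 G hG).2.1⟩) hR hnorm
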